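/- For a Borel measure $\mu$ on $\mathbb{R}^n$ let $$M(\mu)=\Big\{\int_{\mathbb{R}^n} y f(y)\,d\mu(y)\ :\ f:\mathbb{R}^n\to[0,1]\text{ measurable},\ \int_{\mathbb{R}^n} f\,d\mu=1,\ \int_{\mathbb{R}^n}|y|f(y)\,d\mu(y)<\infty\Big\}.$$ For a convex body $K\subseteq\mathbb{R}^n$ (a compact convex set with non-empty interior) containing the origin, with gauge function $\|x\|_K=\inf\{r>0: x\in rK\}$, and for $R>0$, put $$d_R^*(K)=\inf\Big\{\mu(\mathbb{R}^n)\ :\ \tfrac1R M(\mu)\subseteq K\subseteq M(\mu)\Big\},\qquad D_R^*(K)=\inf\Big\{\int_{\mathbb{R}^n}\|x\|_K\,d\mu(x)\ :\ \tfrac1R M(\mu)\subseteq K\subseteq M(\mu)\Big\},$$ where the infima are taken in $[0,\infty]$ over all Borel measures $\mu$ on $\mathbb{R}^n$. **Theorem.** There exists a universal constant $C>0$ such that for every $n\ge 1$ and every centrally-symmetric convex body $K\subseteq\mathbb{R}^n$ (that is, $K=-K$), $$d_{\sqrt n}^*(K)\le C\qquad\text{and}\qquad D_{\sqrt n}^*(K)\le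 Cn .$$ -/

import Mathlib

open MeasureTheory
open scoped Pointwise ENNReal

/-- The metronoid `M(μ)` generated by a Borel measure `μ` on `ℝⁿ`: the set of all vectors
`∫ y f(y) dμ(y)`, where `f : ℝⁿ → [0,1]` is measurable and `∫ f dμ = 1`. The vector has to exist,
so `y ↦ f(y) y` is required to be integrable. -/
def metronoid {n : ℕ} (μ : Measure (EuclideanSpace ℝ (Fin n))) :
    Set (EuclideanSpace ℝ (Fin n)) :=
  {x | ∃ f : EuclideanSpace ℝ (Fin n) → ℝ,
    Measurable f ∧ (∀ y, f y ∈ Set.Icc (0 : ℝ) 1) ∧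
    Integrable f μ ∧ ∫ y, f y ∂μ = 1 ∧
    Integrable (fun y => f y • y) μ ∧ ∫ y, f y • y ∂μ = x}

/-- The measure `μ` generates an approximation of `K` from outside, up to the factor `R`:
`(1/R) M(μ) ⊆ K ⊆ M(μ)`. -/
def MetApprox {n : ℕ} (R : ℝ) (K : Set (EuclideanSpace ℝ (Fin n)))
    (μ : Measure (EuclideanSpace ℝ (Fin n))) : Prop :=
  (1 / R) • metronoid μ ⊆ K ∧ K ⊆ metronoid μ

/-- `d*_R(K)`: the infimum of the total masses `μ(ℝⁿ)` over all Borel measures `μ` with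
`(1/R) M(μ) ⊆ K ⊆ M(μ)`, as an element of `[0, ∞]` (it is `∞` if there is no such `μ`). -/
noncomputable def dStar {n : ℕ} (R : ℝ) (K : Set (EuclideanSpace ℝ (Fin n))) : ℝ≥0∞ :=
  ⨅ (μ : Measure (EuclideanSpace ℝ (Fin n))) (_ : MetApprox R K μ), μ Set.univ

/-- `D*_R(K)`: the infimum of the costs `∫ ‖x‖_K dμ(x)`, with `‖·‖_K` the gauge function of `K`,
over all Borel measures `μ` with `(1/R) M(μ) ⊆ K ⊆ M(μ)`, as an element of `[0, ∞]`. -/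
noncomputable def DStar {n : ℕ} (R : ℝ) (K : Set (EuclideanSpace ℝ (Fin n))) : ℝ≥0∞ :=
  ⨅ (μ : Measure (EuclideanSpace ℝ (Fin n))) (_ : MetApprox R K μ),
    ∫⁻ x, ENNReal.ofReal (gauge K x) ∂μ

/-! By John's theorem some ellipsoid `{‖A x‖ ≤ 1}` contains `K` and lies in `√n • K`, so it suffices
to realise ellipsoids as metronoids of cheap measures (`metronoid_twoGaussian`). Let `b` be the mean
of `|g|` for a standard real Gaussian `g`. For twice the standard Gaussian, the weights are
functions `p` of Gaussian mean `1/2`. Half-spaces through the origin are extremal, and rotation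
invariance makes the metronoid the ball of radius `b`. Pushing forward by a linear map gives every
ellipsoid, always with mass `2`. For the cost, the John inclusion bounds the gauge of `K` at `L z`
by `(√n / b) ‖z‖`, and the Gaussian mean of `‖z‖` is at most `√n`, so the cost is at most `2 n / b`.
-/

open ProbabilityTheory Module
open scoped RealInnerProductSpace

/-! ### John's theorem for symmetric bodies. -/

section JohnEllipsoid

variable {E : Type*} [NormedAddCommGroup E] [InnerProductSpace ℝ E] [FiniteDimensional ℝ E]

/-- With `t = n q` and `s = 1 - t`, the left side is at most `exp (t s) ≤ 1 / (1 - t s)`, and `(1 +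
s) (1 - t s) = 1 + s² (1 - t) > 1`. This is the determinant estimate for the slab map below. -/
lemma one_add_mul_pow_lt_one_add (n : ℕ) {q : ℝ} (hq : 0 ≤ q) (hnq : n * q < 1) :
    (1 + (1 - n * q) * q) ^ n < 1 + (1 - n * q) := by
  set t : ℝ := n * q
  set s : ℝ := 1 - t
  have hs : 0 < s := by simp only [s]; linarith
  have ht : 0 ≤ t := by positivity
  have hts : 0 < 1 - t * s := by simp only [s]; nlinarith
  have h1 : (1 + s * q) ^ n ≤ Real.exp (t * s) := by
    have : Real.exp (t * s) = Real.exp (s * q) ^ n := by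
      rw [← Real.exp_nat_mul]; congr 1; simp only [t]; ring
    rw [this]
    have := Real.add_one_le_exp (s * q)
    exact pow_le_pow_left₀ (by positivity) (by linarith) n
  have h2 : Real.exp (t * s) * (1 - t * s) ≤ 1 := by
    have h := Real.one_sub_le_exp_neg (t * s)
    calc Real.exp (t * s) * (1 - t * s) ≤ Real.exp (t * s) * Real.exp (-(t * s)) := by gcongr
      _ = 1 := by rw [← Real.exp_add]; simp
  have h3 : 1 < (1 + s) * (1 - t * s) := by
    have : (1 + s) * (1 - t * s) = 1 + s ^ 2 * (1 - t) := by simp only [s]; ring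
    rw [this]
    have : 0 < s ^ 2 * (1 - t) := by positivity
    linarith
  refine h1.trans_lt ?_
  by_contra! h
  nlinarith

/-- A linear map expanding the direction `w` with determinant larger than `1`, that still maps the
slab `|⟪w, x⟫| ≤ h` of the unit ball into the unit ball. -/
lemma exists_continuousLinearMap_one_lt_det_of_slab {w : E} (hw : ‖w‖ = 1) {h : ℝ}
    (hh : finrank ℝ E * h ^ 2 < 1) :
    ∃ D : E →L[ℝ] E, 1 < D.det ∧ ∀ x, ‖x‖ ≤ 1 → |⟪w, x⟫| ≤ h → ‖D x‖ ≤ 1 := by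
  set n := finrank ℝ E
  -- The map stretches `w` by `c = √(1 + s)` and then scales by `β`. On the slab the stretched
  -- vector has squared norm at most `1 + s h²`, which `β` normalises; the determinant is `β ^ n *
  -- c`.
  set s : ℝ := 1 - n * h ^ 2
  have hs : 0 < s := by simp only [s]; linarith
  have hden : 0 < 1 + s * h ^ 2 := by positivity
  set c := √(1 + s)
  have hc : c ^ 2 = 1 + s := Real.sq_sqrt (by positivity)
  have hcpos : 0 < c := Real.sqrt_pos.2 (by positivity)
  set β := (√(1 + s * h ^ 2))⁻¹
  have hβpos : 0 < β := inv_pos.2 (Real.sqrt_pos.2 hden)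
  have hβ : β ^ 2 * (1 + s * h ^ 2) = 1 := by
    simp only [β]; rw [inv_pow, Real.sq_sqrt hden.le]; field_simp
  refine ⟨LinearMap.toContinuousLinearMap
    (β • LinearMap.transvection (innerₛₗ ℝ w) ((c - 1) • w)), ?_, fun x hx hxw => ?_⟩
  · have hdet : ContinuousLinearMap.det (LinearMap.toContinuousLinearMap
        (β • LinearMap.transvection (innerₛₗ ℝ w) ((c - 1) • w))) = β ^ n * c := by
      rw [ContinuousLinearMap.det, LinearMap.coe_toContinuousLinearMap, LinearMap.det_smul,
        LinearMap.transvection.det]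
      simp [hw, n]
    rw [hdet, ← one_lt_sq_iff₀ (by positivity), mul_pow, hc, ← pow_mul, mul_comm n 2, pow_mul,
      eq_inv_of_mul_eq_one_left hβ, inv_pow, ← div_eq_inv_mul, one_lt_div (by positivity)]
    exact one_add_mul_pow_lt_one_add n (sq_nonneg h) hh
  · rw [← sq_le_one_iff₀ (norm_nonneg _)]
    have hsq : ‖x + ⟪w, x⟫ • (c - 1) • w‖ ^ 2 = ‖x‖ ^ 2 + s * ⟪w, x⟫ ^ 2 := by
      rw [norm_add_sq_real, norm_smul, norm_smul, hw, mul_pow, mul_pow, Real.norm_eq_abs,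
        Real.norm_eq_abs, sq_abs, sq_abs, inner_smul_right, inner_smul_right, real_inner_comm w x]
      linear_combination ⟪w, x⟫ ^ 2 * hc
    have : ‖β • (x + ⟪w, x⟫ • (c - 1) • w)‖ ^ 2 ≤ 1 := by
      rw [norm_smul, mul_pow, hsq, Real.norm_eq_abs, sq_abs, ← hβ]
      have h1 : ‖x‖ ^ 2 ≤ 1 := pow_le_one₀ (norm_nonneg _) hx
      have h2 : ⟪w, x⟫ ^ 2 ≤ h ^ 2 := sq_le_sq' (abs_le.1 hxw).1 (abs_le.1 hxw).2
      gcongr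
    simpa [LinearMap.transvection.apply] using this

omit [FiniteDimensional ℝ E] in
lemma exists_closedBall_zero_subset_of_neg_eq {K : Set E} (hK : Convex ℝ K)
    (hint : (interior K).Nonempty) (hsymm : -K = K) :
    ∃ r > 0, Metric.closedBall (0 : E) r ⊆ K := by
  obtain ⟨x, hx⟩ := hint
  have hx' : -x ∈ interior K := by
    have h := (Homeomorph.neg E).preimage_interior K
    rw [Homeomorph.coe_neg, Set.neg_preimage, Set.neg_preimage, hsymm] at h
    rw [← h]
    simpa using hx
  have h0 : (0 : E) ∈ interior K := by
    have := hK.interior hx hx' (a := 1 / 2) (b := 1 / 2) (by norm_num) (by norm_num) (by norm_num)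
    simpa using this
  exact Metric.nhds_basis_closedBall.mem_iff.1 (mem_interior_iff_mem_nhds.1 h0)

lemma isCompact_setOf_norm_map_le_one {K : Set E} {r : ℝ} (hr : 0 < r)
    (hrK : Metric.closedBall (0 : E) r ⊆ K) :
    IsCompact {A : E →L[ℝ] E | ∀ x ∈ K, ‖A x‖ ≤ 1} := by
  have : ProperSpace (E →L[ℝ] E) := FiniteDimensional.proper ℝ _
  refine Metric.isCompact_of_isClosed_isBounded ?_ ?_
  · simp only [Set.ofPred_forall]
    exact isClosed_biInter fun x _ => isClosed_le (by fun_prop) continuous_const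
  · refine isBounded_iff_forall_norm_le.2 ⟨r⁻¹, fun A hA => ?_⟩
    refine A.opNorm_le_bound (by positivity) fun x => ?_
    rcases eq_or_ne x 0 with rfl | hx
    · simp
    have hx' : 0 < ‖x‖ := norm_pos_iff.2 hx
    have h := hA ((r / ‖x‖) • x) (hrK (by
      rw [mem_closedBall_zero_iff, norm_smul, Real.norm_of_nonneg (by positivity)]
      exact (div_mul_cancel₀ _ hx'.ne').le))
    rw [map_smul, norm_smul, Real.norm_of_nonneg (by positivity), div_mul_eq_mul_div,
      div_le_one hx'] at h
    rw [inv_mul_eq_div, le_div_iff₀ hr]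
    linarith

/-- **John's theorem** for symmetric convex bodies: some ellipsoid `{x | ‖A x‖ ≤ 1}` contains `K`
and is contained in `√n • K`. -/
theorem exists_john_ellipsoid_of_neg_eq {K : Set E} (hc : IsCompact K) (hK : Convex ℝ K)
    (hint : (interior K).Nonempty) (hsymm : -K = K) :
    ∃ A : E ≃L[ℝ] E, (∀ x ∈ K, ‖A x‖ ≤ 1) ∧ ∀ x, √(finrank ℝ E) * ‖A x‖ ≤ 1 → x ∈ K := by
  obtain ⟨r, hr, hrK⟩ := exists_closedBall_zero_subset_of_neg_eq hK hint hsymm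
  set S := {A : E →L[ℝ] E | ∀ x ∈ K, ‖A x‖ ≤ 1}
  -- Maximising `|det A|` amounts to minimising the volume of the ellipsoid containing `K`.
  obtain ⟨A, hAS, hAmax⟩ := (isCompact_setOf_norm_map_le_one hr hrK).exists_isMaxOn
    (f := fun A => |A.det|) ⟨0, by simp⟩ ContinuousLinearMap.continuous_det.abs.continuousOn
  have hAdet : A.det ≠ 0 := by
    obtain ⟨M, hM, hKM⟩ := hc.isBounded.exists_pos_norm_le
    have hmem : M⁻¹ • ContinuousLinearMap.id ℝ E ∈ S := fun x hx => by
      rw [smul_apply, norm_smul, Real.norm_of_nonneg (by positivity),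
        ContinuousLinearMap.id_apply, inv_mul_le_one₀ hM]
      exact hKM x hx
    have hle := hAmax hmem
    have hdet : (M⁻¹ • ContinuousLinearMap.id ℝ E).det = M⁻¹ ^ finrank ℝ E := by
      simp [ContinuousLinearMap.det]
    simp only [Set.mem_ofPred_eq, hdet] at hle
    exact abs_pos.1 (lt_of_lt_of_le (by positivity) hle)
  let A' := A.toContinuousLinearEquivOfDetNeZero hAdet
  have hA' : ∀ x, A' x = A x := fun x => rfl
  refine ⟨A', hAS, fun y hy => ?_⟩
  by_contra hyK
  -- Separating `y` from `K` confines `A K`, by symmetry, to a slab of half-width `b / ‖v‖ < ‖A y‖ ≤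
  -- 1 / √n`. Composing `A` with the slab map then contradicts maximality.
  obtain ⟨f, b, hfb, hby⟩ := geometric_hahn_banach_closed_point hK hc.isClosed hyK
  have hb : 0 < b := by simpa using hfb 0 (hrK (by simp [hr.le]))
  let g : StrongDual ℝ E := f.comp (A'.symm : E →L[ℝ] E)
  set v := (InnerProductSpace.toDual ℝ E).symm g
  have hv : ∀ x, ⟪v, A x⟫ = f x := fun x => by
    rw [InnerProductSpace.toDual_symm_apply, ← hA']
    simp [g]
  have hfy : f y ≤ ‖v‖ * ‖A y‖ := by rw [← hv]; exact real_inner_le_norm _ _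
  have hvpos : 0 < ‖v‖ := by
    by_contra! h
    have : ‖v‖ = 0 := le_antisymm h (norm_nonneg _)
    rw [this] at hfy
    linarith
  have hslab : ∀ x ∈ K, |⟪‖v‖⁻¹ • v, A x⟫| ≤ b / ‖v‖ := fun x hx => by
    have hx' : -x ∈ K := by rw [← hsymm]; simpa using hx
    have h1 := hfb x hx
    have h2 := hfb (-x) hx'
    rw [map_neg] at h2
    rw [real_inner_smul_left, hv, abs_mul, abs_of_pos (inv_pos.2 hvpos), inv_mul_eq_div]
    gcongr
    exact abs_le.2 ⟨by linarith, h1.le⟩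
  have hsmall : finrank ℝ E * (b / ‖v‖) ^ 2 < 1 := by
    have hn : 0 < finrank ℝ E := by
      have : Nontrivial E := ⟨v, 0, norm_pos_iff.1 hvpos⟩
      exact finrank_pos
    have hlt : b / ‖v‖ < ‖A y‖ := by rw [div_lt_iff₀ hvpos]; linarith
    have hsqrt : 0 < √(finrank ℝ E : ℝ) := Real.sqrt_pos.2 (by exact_mod_cast hn)
    rw [hA'] at hy
    have hlt' : √(finrank ℝ E : ℝ) * (b / ‖v‖) < 1 := (mul_lt_mul_of_pos_left hlt hsqrt).trans_le hy
    have := pow_lt_one₀ (by positivity) hlt' two_ne_zero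
    rwa [mul_pow, Real.sq_sqrt (by positivity)] at this
  obtain ⟨D, hD, hDx⟩ := exists_continuousLinearMap_one_lt_det_of_slab
    (w := ‖v‖⁻¹ • v) (norm_smul_inv_norm (𝕜 := ℝ) (norm_pos_iff.1 hvpos)) hsmall
  have hle := hAmax (show D.comp A ∈ S from fun x hx => hDx _ (hAS x hx) (hslab x hx))
  have hdet : (D.comp A).det = D.det * A.det := LinearMap.det_comp _ _
  simp only [Set.mem_ofPred_eq, hdet, abs_mul] at hle
  have : |A.det| * 1 < |A.det| * |D.det| :=
    mul_lt_mul_of_pos_left (hD.trans_le (le_abs_self _)) (abs_pos.2 hAdet)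
  linarith

end JohnEllipsoid

/-! ### Moments and symmetries of the standard Gaussian. -/

section StdGaussian

variable {E : Type*} [NormedAddCommGroup E] [InnerProductSpace ℝ E] [FiniteDimensional ℝ E]
  [MeasurableSpace E] [BorelSpace E]

lemma stdGaussian_map_inner {u : E} (hu : ‖u‖ = 1) :
    (stdGaussian E).map (fun z => ⟪u, z⟫) = gaussianReal 0 1 := by
  have h := IsGaussian.map_eq_gaussianReal (μ := stdGaussian E) (innerSL ℝ u)
  rw [integral_strongDual_stdGaussian, variance_dual_stdGaussian, innerSL_apply_norm, hu] at h
  simpa using h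

lemma integral_abs_inner_stdGaussian {u : E} (hu : ‖u‖ = 1) :
    ∫ z, |⟪u, z⟫| ∂(stdGaussian E) = ∫ x, |x| ∂(gaussianReal 0 1) := by
  rw [← stdGaussian_map_inner hu, integral_map (by fun_prop) (by fun_prop)]

lemma integral_abs_gaussianReal_pos : 0 < ∫ x, |x| ∂(gaussianReal 0 1) := by
  have : NullSingletonClass (gaussianReal 0 1) := nullSingletonClass_gaussianReal one_ne_zero
  have hint : Integrable (fun x : ℝ => |x|) (gaussianReal 0 1) := IsGaussian.integrable_id.abs
  rw [integral_pos_iff_support_of_nonneg (fun x => abs_nonneg x) hint]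
  have : Function.support (fun x : ℝ => |x|) = {0}ᶜ := by ext; simp
  rw [this, prob_compl_eq_one_sub (measurableSet_singleton _), measure_singleton]
  simp

lemma measurePreserving_stdGaussian (e : E ≃ₗᵢ[ℝ] E) :
    MeasurePreserving e (stdGaussian E) (stdGaussian E) :=
  ⟨e.continuous.measurable, stdGaussian_map e⟩

lemma integral_comp_stdGaussian {F : Type*} [NormedAddCommGroup F] [NormedSpace ℝ F]
    (e : E ≃ₗᵢ[ℝ] E) (g : E → F) :
    ∫ z, g (e z) ∂(stdGaussian E) = ∫ z, g z ∂(stdGaussian E) :=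
  (measurePreserving_stdGaussian e).integral_comp e.toHomeomorph.measurableEmbedding g

lemma measurable_real_sign : Measurable Real.sign := by
  unfold Real.sign
  exact Measurable.ite measurableSet_Iio measurable_const
    (Measurable.ite measurableSet_Ioi measurable_const measurable_const)

lemma abs_real_sign_le_one (x : ℝ) : |Real.sign x| ≤ 1 := by
  obtain h | h | h := Real.sign_apply_eq x <;> simp [h]

lemma measurable_sign_inner (u : E) : Measurable fun z => Real.sign ⟪u, z⟫ :=
  measurable_real_sign.comp (by fun_prop)

lemma integral_sign_inner_stdGaussian (u : E) :
    ∫ z, Real.sign ⟪u, z⟫ ∂(stdGaussian E) = 0 := by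
  have h := integral_comp_stdGaussian (LinearIsometryEquiv.neg ℝ) (fun z : E => Real.sign ⟪u, z⟫)
  simp only [LinearIsometryEquiv.coe_neg, inner_neg_right, Real.sign_neg,
    integral_neg] at h
  linarith

lemma integrable_sign_inner_stdGaussian (u : E) :
    Integrable (fun z => Real.sign ⟪u, z⟫) (stdGaussian E) :=
  Integrable.of_bound (measurable_sign_inner u).aestronglyMeasurable 1 (.of_forall fun _ => abs_real_sign_le_one _)

lemma integrable_sign_inner_smul_stdGaussian (u : E) :
    Integrable (fun z => Real.sign ⟪u, z⟫ • z) (stdGaussian E) :=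
  Integrable.bdd_smul (C := 1) IsGaussian.integrable_fun_id
    (measurable_sign_inner u).aestronglyMeasurable (.of_forall fun _ => abs_real_sign_le_one _)

/-- The reflection fixing the line of `u` preserves both the Gaussian and `⟪u, z⟫`, so the integral
lies on that line; its coefficient is the mean of `|⟪u, z⟫|`. -/
lemma integral_sign_inner_smul_stdGaussian {u : E} (hu : ‖u‖ = 1) :
    ∫ z, Real.sign ⟪u, z⟫ • z ∂(stdGaussian E) = (∫ x, |x| ∂(gaussianReal 0 1)) • u := by
  set I := ∫ z, Real.sign ⟪u, z⟫ • z ∂(stdGaussian E) with hI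
  have hinner : ⟪u, I⟫ = ∫ x, |x| ∂(gaussianReal 0 1) := by
    rw [← integral_abs_inner_stdGaussian hu, hI,
      ← integral_inner (integrable_sign_inner_smul_stdGaussian u)]
    congr with z
    rw [real_inner_smul_right]
    rcases lt_trichotomy ⟪u, z⟫ 0 with h | h | h
    · rw [Real.sign_of_neg h, abs_of_neg h]; ring
    · simp [h]
    · rw [Real.sign_of_pos h, abs_of_pos h]; ring
  let ρ := (ℝ ∙ u).reflection
  have hρ : ∀ z, ρ z = 2 • ⟪u, z⟫ • u - z := fun z => by
    simp [ρ, Submodule.reflection_singleton_apply, hu]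
  have hρu : ∀ z, ⟪u, ρ z⟫ = ⟪u, z⟫ := fun z => by
    rw [hρ, inner_sub_right, two_nsmul, inner_add_right, real_inner_smul_right,
      real_inner_self_eq_norm_sq, hu]
    ring
  have hfix : ρ I = I := by
    conv_rhs => rw [hI, ← integral_comp_stdGaussian ρ]
    simp only [hρu, ← map_smul]
    exact (ρ.toContinuousLinearEquiv.integral_comp_comm _).symm
  rw [hρ, sub_eq_iff_eq_add, ← two_nsmul] at hfix
  rw [← hinner]
  have h2 : (2 : ℝ) • (⟪u, I⟫ • u) = (2 : ℝ) • I := by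
    simpa only [two_nsmul, two_smul] using hfix
  exact (smul_right_injective E (two_ne_zero (α := ℝ)) h2).symm

lemma integral_norm_sq_stdGaussian :
    ∫ z, ‖z‖ ^ 2 ∂(stdGaussian E) = finrank ℝ E := by
  let b := stdOrthonormalBasis ℝ E
  have hL2 (i) : Integrable (fun z => ⟪b i, z⟫ ^ 2) (stdGaussian E) :=
    ((innerSL ℝ (b i)).comp_memLp' IsGaussian.memLp_two_id).integrable_sq
  have h1 (i) : ∫ z, ⟪b i, z⟫ ^ 2 ∂(stdGaussian E) = 1 := by
    have h := variance_dual_stdGaussian (innerSL ℝ (b i))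
    rw [variance_of_integral_eq_zero (by fun_prop) (integral_strongDual_stdGaussian _)] at h
    simpa using h
  simp_rw [← b.sum_sq_inner_right]
  rw [integral_finsetSum _ fun i _ => hL2 i]
  simp [h1]

/-- Nonnegativity of the variance of `‖z‖`, whose second moment is the dimension. -/
lemma integral_norm_stdGaussian_le :
    ∫ z, ‖z‖ ∂(stdGaussian E) ≤ √(finrank ℝ E) := by
  have h := variance_nonneg (fun z : E => ‖z‖) (stdGaussian E)
  have hL2 : MemLp (fun z : E => ‖z‖) 2 (stdGaussian E) := IsGaussian.memLp_two_id.norm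
  rw [variance_eq_sub hL2] at h
  have h2 := integral_norm_sq_stdGaussian (E := E)
  simp only [Pi.pow_apply, h2] at h
  exact Real.le_sqrt_of_sq_le (by linarith)

end StdGaussian
-- Ellipsoids as Gaussian metronoids, and their cost.
section Metronoid

/-- Pair the integral with its own direction `u`: `p z * ⟪u, z⟫` is at most the positive part of
`⟪u, z⟫`, whose mean is half that of `|⟪u, z⟫|`. -/
lemma norm_integral_smul_stdGaussian_le {E : Type*} [NormedAddCommGroup E] [InnerProductSpace ℝ E]
    [FiniteDimensional ℝ E] [MeasurableSpace E] [BorelSpace E] {p : E → ℝ} (hp : Measurable p)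
    (hp01 : ∀ z, p z ∈ Set.Icc (0 : ℝ) 1) :
    ‖∫ z, p z • z ∂(stdGaussian E)‖ ≤ (∫ x, |x| ∂(gaussianReal 0 1)) / 2 := by
  set I := ∫ z, p z • z ∂(stdGaussian E) with hI
  rcases eq_or_ne I 0 with h0 | h0
  · rw [h0, norm_zero]
    exact (half_pos integral_abs_gaussianReal_pos).le
  have hu : ‖‖I‖⁻¹ • I‖ = 1 := norm_smul_inv_norm (𝕜 := ℝ) h0
  set u := ‖I‖⁻¹ • I
  have hint : Integrable (fun z => p z • z) (stdGaussian E) :=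
    Integrable.bdd_smul (C := 1) IsGaussian.integrable_fun_id hp.aestronglyMeasurable
      (.of_forall fun z => by rw [Real.norm_of_nonneg (hp01 z).1]; exact (hp01 z).2)
  have hlin : Integrable (fun z => ⟪u, z⟫) (stdGaussian E) :=
    (innerSL ℝ u).integrable_comp IsGaussian.integrable_id
  have hmean : ∫ z, ⟪u, z⟫ ∂(stdGaussian E) = 0 :=
    integral_strongDual_stdGaussian (innerSL ℝ u)
  calc ‖I‖ = ⟪u, I⟫ := by
        rw [real_inner_smul_left, real_inner_self_eq_norm_sq, sq, inv_mul_cancel_left₀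
          (norm_ne_zero_iff.2 h0)]
    _ = ∫ z, ⟪u, p z • z⟫ ∂(stdGaussian E) := (integral_inner hint u).symm
    _ ≤ ∫ z, (⟪u, z⟫ + |⟪u, z⟫|) / 2 ∂(stdGaussian E) := by
        refine integral_mono ((innerSL ℝ u).integrable_comp hint)
          ((hlin.add hlin.abs).div_const 2) fun z => ?_
        obtain ⟨h1, h2⟩ := hp01 z
        simp only [real_inner_smul_right]
        rcases abs_cases ⟪u, z⟫ with h | h <;> nlinarith
    _ = (∫ x, |x| ∂(gaussianReal 0 1)) / 2 := by
        rw [integral_div, integral_add hlin hlin.abs, hmean, integral_abs_inner_stdGaussian hu,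
          zero_add]

/-- Interpolate between the constant `1/2` and the half-space weight `1/2 + sign ⟪u, z⟫ / 2`. The
sign term is odd, so the mean stays `1/2`, while the barycentre moves along `u`. -/
lemma exists_integral_smul_stdGaussian_eq {E : Type*} [NormedAddCommGroup E]
    [InnerProductSpace ℝ E] [FiniteDimensional ℝ E] [MeasurableSpace E] [BorelSpace E] {u : E}
    (hu : ‖u‖ = 1) {t : ℝ} (ht0 : 0 ≤ t) (ht : t ≤ ∫ x, |x| ∂(gaussianReal 0 1)) :
    ∃ p : E → ℝ, Measurable p ∧ (∀ z, p z ∈ Set.Icc (0 : ℝ) 1) ∧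
      Integrable p (stdGaussian E) ∧ ∫ z, p z ∂(stdGaussian E) = 1 / 2 ∧
      Integrable (fun z => p z • z) (stdGaussian E) ∧
      ∫ z, p z • z ∂(stdGaussian E) = (t / 2) • u := by
  have hb := integral_abs_gaussianReal_pos
  have hbu := integral_sign_inner_smul_stdGaussian hu
  generalize ∫ x, |x| ∂(gaussianReal 0 1) = b at ht hb hbu
  -- The sign term contributes `(τ b) • u`, which must equal `(t / 2) • u`.
  set τ := t / b / 2 with hτdef
  have hτ : |τ| ≤ 1 / 2 := by
    rw [abs_of_nonneg (by positivity)]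
    have := (div_le_one hb).2 ht
    linarith
  have hsgn := (integrable_sign_inner_stdGaussian u).const_mul τ
  have hid : Integrable (fun z : E => (1 / 2 : ℝ) • z) (stdGaussian E) :=
    IsGaussian.integrable_fun_id.smul (1 / 2 : ℝ)
  have hsgnz : Integrable (fun z : E => τ • Real.sign ⟪u, z⟫ • z) (stdGaussian E) :=
    (integrable_sign_inner_smul_stdGaussian u).smul τ
  refine ⟨fun z => 1 / 2 + τ * Real.sign ⟪u, z⟫, ((measurable_sign_inner u).const_mul _).const_add _,
    fun z => ?_, (integrable_const _).add hsgn, ?_, ?_, ?_⟩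
  · have h : |τ * Real.sign ⟪u, z⟫| ≤ 1 / 2 := by
      rw [abs_mul]
      exact (mul_le_of_le_one_right (abs_nonneg _) (abs_real_sign_le_one _)).trans hτ
    rw [abs_le] at h
    exact ⟨by linarith [h.1], by linarith [h.2]⟩
  · rw [integral_add (integrable_const _) hsgn, integral_const_mul,
      integral_sign_inner_stdGaussian]
    simp
  · simp only [add_smul, mul_smul]
    exact hid.add hsgnz
  · simp only [add_smul, mul_smul]
    rw [integral_add hid hsgnz, integral_smul, integral_smul, integral_id_stdGaussian, hbu,
      smul_zero, zero_add, smul_smul]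
    congr 1
    rw [hτdef]
    field_simp

variable {n : ℕ}

/-- The image of twice the standard Gaussian measure under `L`. -/
noncomputable def twoGaussian (L : EuclideanSpace ℝ (Fin n) ≃L[ℝ] EuclideanSpace ℝ (Fin n)) :
    Measure (EuclideanSpace ℝ (Fin n)) :=
  (2 : ℝ≥0∞) • (stdGaussian (EuclideanSpace ℝ (Fin n))).map L

variable (L : EuclideanSpace ℝ (Fin n) ≃L[ℝ] EuclideanSpace ℝ (Fin n))

lemma twoGaussian_univ : twoGaussian L Set.univ = 2 := by
  simp [twoGaussian, Measure.map_apply L.continuous.measurable MeasurableSet.univ]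

lemma integral_twoGaussian {F : Type*} [NormedAddCommGroup F] [NormedSpace ℝ F]
    (g : EuclideanSpace ℝ (Fin n) → F) :
    ∫ y, g y ∂(twoGaussian L) = (2 : ℝ) • ∫ z, g (L z) ∂(stdGaussian _) := by
  rw [twoGaussian, integral_smul_measure, ENNReal.toReal_ofNat]
  congr 1
  exact L.toHomeomorph.measurableEmbedding.integral_map g

lemma integrable_twoGaussian_iff {F : Type*} [NormedAddCommGroup F]
    {g : EuclideanSpace ℝ (Fin n) → F} :
    Integrable g (twoGaussian L) ↔ Integrable (fun z => g (L z)) (stdGaussian _) := by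
  rw [twoGaussian, integrable_smul_measure two_ne_zero ENNReal.ofNat_ne_top]
  exact L.toHomeomorph.measurableEmbedding.integrable_map_iff

theorem metronoid_twoGaussian [NeZero n] :
    metronoid (twoGaussian L) = {x | ‖L.symm x‖ ≤ ∫ x, |x| ∂(gaussianReal 0 1)} := by
  ext x
  rw [Set.mem_ofPred_eq]
  constructor
  · rintro ⟨f, hf, hf01, -, -, -, rfl⟩
    have h := norm_integral_smul_stdGaussian_le (hf.comp L.continuous.measurable)
      (fun z => hf01 (L z))
    rw [integral_twoGaussian]
    simp only [← map_smul, L.integral_comp_comm, L.symm_apply_apply, Function.comp_def] at h ⊢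
    rw [norm_smul, Real.norm_ofNat]
    linarith
  · intro hx
    obtain ⟨u, hu, hxu⟩ : ∃ u : EuclideanSpace ℝ (Fin n), ‖u‖ = 1 ∧ L.symm x = ‖L.symm x‖ • u := by
      rcases eq_or_ne (L.symm x) 0 with h0 | h0
      · exact ⟨EuclideanSpace.single 0 1, by simp, by simp [h0]⟩
      · exact ⟨‖L.symm x‖⁻¹ • L.symm x, norm_smul_inv_norm (𝕜 := ℝ) h0,
          by rw [smul_inv_smul₀ (norm_ne_zero_iff.2 h0)]⟩
    obtain ⟨p, hp, hp01, hpint, hp1, hpz, hpx⟩ :=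
      exists_integral_smul_stdGaussian_eq hu (norm_nonneg _) hx
    refine ⟨fun y => p (L.symm y), hp.comp L.symm.continuous.measurable, fun y => hp01 _, ?_, ?_,
      ?_, ?_⟩
    · rw [integrable_twoGaussian_iff]
      simpa only [L.symm_apply_apply] using hpint
    · rw [integral_twoGaussian]
      simp only [L.symm_apply_apply, hp1]
      norm_num
    · rw [integrable_twoGaussian_iff]
      simp only [L.symm_apply_apply, ← map_smul]
      exact L.toContinuousLinearMap.integrable_comp hpz
    · rw [integral_twoGaussian]
      simp only [L.symm_apply_apply, ← map_smul, L.integral_comp_comm]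
      rw [← L.eq_symm_apply, hpx, smul_smul, mul_div_cancel₀ _ two_ne_zero]
      exact hxu.symm

lemma lintegral_gauge_twoGaussian_le {K : Set (EuclideanSpace ℝ (Fin n))} {a : ℝ} (ha : 0 ≤ a)
    (hK : ∀ z, gauge K (L z) ≤ a * ‖z‖) :
    ∫⁻ x, ENNReal.ofReal (gauge K x) ∂(twoGaussian L) ≤ ENNReal.ofReal (2 * a * √n) := by
  have hint : Integrable (fun z => a * ‖z‖) (stdGaussian (EuclideanSpace ℝ (Fin n))) :=
    IsGaussian.integrable_fun_id.norm.const_mul a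
  have hmap := L.toHomeomorph.measurableEmbedding.lintegral_map
    (μ := stdGaussian (EuclideanSpace ℝ (Fin n))) (fun x => ENNReal.ofReal (gauge K x))
  rw [ContinuousLinearEquiv.coe_toHomeomorph] at hmap
  rw [twoGaussian, lintegral_smul_measure, hmap, smul_eq_mul]
  calc 2 * ∫⁻ z, ENNReal.ofReal (gauge K (L z)) ∂(stdGaussian _)
      ≤ 2 * ∫⁻ z, ENNReal.ofReal (a * ‖z‖) ∂(stdGaussian (EuclideanSpace ℝ (Fin n))) := by
        gcongr with z
        exact hK z
    _ = ENNReal.ofReal (2 * ∫ z, a * ‖z‖ ∂(stdGaussian (EuclideanSpace ℝ (Fin n)))) := by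
        rw [← ofReal_integral_eq_lintegral_ofReal hint (.of_forall fun z => by positivity),
          ENNReal.ofReal_mul zero_le_two, ENNReal.ofReal_ofNat]
    _ ≤ ENNReal.ofReal (2 * a * √n) := by
        have h := integral_norm_stdGaussian_le (E := EuclideanSpace ℝ (Fin n))
        rw [finrank_euclideanSpace_fin] at h
        rw [integral_const_mul, mul_assoc]
        gcongr

/-- Every centrally symmetric convex body is approximated up to the factor `√n` by the metronoid of
a measure of mass `2` whose cost is at most a constant times `n`. -/
theorem exists_metApprox_of_neg_eq [NeZero n] {K : Set (EuclideanSpace ℝ (Fin n))} (hc : IsCompact K)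
    (hK : Convex ℝ K) (hint : (interior K).Nonempty) (hsymm : -K = K) :
    ∃ μ, MetApprox √n K μ ∧ μ Set.univ = 2 ∧
      ∫⁻ x, ENNReal.ofReal (gauge K x) ∂μ ≤
        ENNReal.ofReal (2 / (∫ x, |x| ∂(gaussianReal 0 1)) * n) := by
  set b := ∫ x, |x| ∂(gaussianReal 0 1) with hbdef
  have hb : 0 < b := integral_abs_gaussianReal_pos
  obtain ⟨A, hKA, hAK⟩ := exists_john_ellipsoid_of_neg_eq hc hK hint hsymm
  rw [finrank_euclideanSpace_fin] at hAK
  -- Scaling by `b` turns the metronoid `{‖L.symm x‖ ≤ b}` into the John ellipsoid `{‖A x‖ ≤ 1}`.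
  let L := (A.trans (LinearEquiv.smulOfNeZero ℝ _ b hb.ne').toContinuousLinearEquiv).symm
  have hL : ∀ x, L.symm x = b • A x := fun x => rfl
  have hnorm : ∀ x, ‖L.symm x‖ = b * ‖A x‖ := fun x => by
    rw [hL, norm_smul, Real.norm_of_nonneg hb.le]
  have hmem : ∀ x, x ∈ metronoid (twoGaussian L) ↔ ‖A x‖ ≤ 1 := fun x => by
    rw [metronoid_twoGaussian, Set.mem_ofPred_eq, hnorm, ← hbdef, mul_le_iff_le_one_right hb]
  refine ⟨twoGaussian L, ⟨?_, fun x hx => (hmem x).2 (hKA x hx)⟩, twoGaussian_univ L, ?_⟩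
  · rintro _ ⟨x, hx, rfl⟩
    have hAx := (hmem x).1 hx
    refine hAK _ ?_
    simp only [map_smul, norm_smul, one_div, norm_inv, Real.norm_of_nonneg (Real.sqrt_nonneg _)]
    rw [← mul_assoc]
    exact mul_le_one₀ mul_inv_le_one (norm_nonneg _) hAx
  · have hgauge : ∀ z, gauge K (L z) ≤ √n / b * ‖z‖ := fun z => by
      have hz : ‖z‖ = b * ‖A (L z)‖ := by rw [← hnorm, L.symm_apply_apply]
      set y := L z
      have hz' : √n / b * ‖z‖ = √n * ‖A y‖ := by rw [hz]; field_simp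
      rw [hz']
      -- Away from zero, dividing `y` by `√n * ‖A y‖` lands in the inner ellipsoid, hence in `K`.
      rcases eq_or_ne (√n * ‖A y‖) 0 with h0 | h0
      · have hn : √(n : ℝ) ≠ 0 := (Real.sqrt_pos.2 (Nat.cast_pos.2 (NeZero.pos n))).ne'
        have hAy : A y = 0 := norm_eq_zero.1 ((mul_eq_zero.1 h0).resolve_left hn)
        rw [A.map_eq_zero_iff.1 hAy, gauge_zero, map_zero, norm_zero, mul_zero]
      · refine gauge_le_of_mem (by positivity) ((Set.mem_smul_set_iff_inv_smul_mem₀ h0 _ _).2 ?_)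
        refine hAK _ ?_
        rw [map_smul, norm_smul, norm_inv, Real.norm_of_nonneg (by positivity)]
        refine le_of_eq ?_
        rw [mul_left_comm]
        exact inv_mul_cancel₀ h0
    refine (lintegral_gauge_twoGaussian_le L (by positivity) hgauge).trans_eq ?_
    congr 1
    have := Real.mul_self_sqrt (Nat.cast_nonneg (α := ℝ) n)
    linear_combination 2 / b * this

end Metronoid

theorem theorem1p1 :
    ∃ C : ℝ, 0 < C ∧
      ∀ (n : ℕ), 1 ≤ n →
        ∀ K : ConvexBody (EuclideanSpace ℝ (Fin n)),
          (interior (K : Set (EuclideanSpace ℝ (Fin n)))).Nonempty →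
          -(K : Set (EuclideanSpace ℝ (Fin n))) = (K : Set (EuclideanSpace ℝ (Fin n))) →
            dStar (Real.sqrt n) (K : Set (EuclideanSpace ℝ (Fin n))) ≤ ENNReal.ofReal C ∧
            DStar (Real.sqrt n) (K : Set (EuclideanSpace ℝ (Fin n))) ≤
              ENNReal.ofReal (C * n) := by
  refine ⟨max 2 (2 / ∫ x, |x| ∂(gaussianReal 0 1)), by positivity, fun n hn K hint hsymm => ?_⟩
  have : NeZero n := ⟨Nat.one_le_iff_ne_zero.1 hn⟩
  obtain ⟨μ, hμ, hmass, hcost⟩ :=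
    exists_metApprox_of_neg_eq K.isCompact K.convex hint hsymm
  constructor
  · refine (iInf₂_le μ hμ).trans ?_
    rw [hmass, ← ENNReal.ofReal_ofNat 2]
    exact ENNReal.ofReal_le_ofReal (le_max_left _ _)
  · refine (iInf₂_le μ hμ).trans (hcost.trans (ENNReal.ofReal_le_ofReal ?_))
    gcongr
    exact le_max_right _ _
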